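/- Let $G \ge B \ge 1$. Consider the following game over rounds $t=1,\dots,n$: the learner predicts $x_t\in[-B,B]$, a label $y_t\in[-G,G]$ is revealed, and the learner suffers the loss $f_t(x_t)=(y_t-x_t)^2$. Let the learner run Follow-the-Leading-History (FLH) over projected online gradient descent (OGD), defined as follows. Base learners. For each $j\ge 1$, base learner $j$ starts in round $j$ at an arbitrary point $x_j^{(j)}\in[-B,B]$ and, for $t\ge j$, updates $$x_{t+1}^{(j)}=\Pi_{[-B,B]}\Big(x_t^{(j)}-\tfrac{1}{2(t-j+1)}f_t'(x_t^{(j)})\Big),$$ where $\Pi_{[-B,B]}$ is the projection onto $[-B,B]$ (so its $k$-th update uses step size $1/(2k)$). Aggregation. Let $\zeta=1/(2(G+B)^2)$ and $v_1^{(1)}=1$. In round $t$ the learner plays $x_t=\sum_{j=1}^t v_t^{(j)}x_t^{(j)}$, and after $f_t$ is revealed it sets $v_{t+1}^{(t+1)}=\frac1{t+1}$ and, for $1\le i\le t$, $$v_{t+1}^{(i)}=\Big(1-\frac1{t+1}\Big)\frac{v_t^{(i)}e^{-\zeta f_t(x_t^{(i)})}}{\sum_{j=1}^t v_t^{(j)}e^{-\zeta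 f_t(x_t^{(j)})}}.$$ Then there are an absolute exponent $p$ and a constant $K=K(B,G)>0$ such that for every $n$, all labels $y_1,\dots,y_n\in[-G,G]$ and all initial points of the base learners in $[-B,B]$, the predictions satisfy $x_t\in[-B,B]$ for all $t\le n$ and, simultaneously for every $C_n$ and every comparator sequence $w_1,\dots,w_n$ with $|w_t|\le B$ and $\sum_{t=2}^n|w_t-w_{t-1}|\le C_n$, $$\sum_{t=1}^n\big[(y_t-x_t)^2-(y_t-w_t)^2\big]\le K\,(1+\log n)^p\,\max\{n^{1/3}C_n^{2/3},\,1\}$$ (for $n=0$ the left side is the empty sum and $\log 0$ is read as $0$). That is, the dynamic regret is $\tilde O(n^{1/3}C_n^{2/3}\vee 1)$. The algorithm uses neither $n$ nor $C_n$. -/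

import Mathlib

noncomputable section

namespace FLHOGD

/-- The Euclidean projection of the real line onto `[-B, B]`. -/
def proj (B x : ℝ) : ℝ := max (-B) (min B x)

/-- Projected online gradient descent on `[-B, B]` with initial point `x₁`. Here `g k` is the loss
revealed in the learner's own round `k + 1`, `η k` is the step size of its `k`-th update, and
`ogd B x₁ η g k` is its prediction in its own round `k + 1` (after `k` updates). -/
def ogd (B x₁ : ℝ) (η : ℕ → ℝ) (g : ℕ → ℝ → ℝ) : ℕ → ℝ
  | 0 => x₁
  | k + 1 => proj B (ogd B x₁ η g k - η (k + 1) * deriv (g k) (ogd B x₁ η g k))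

/-- The weights of Follow-the-Leading-History. Rounds and base learners are numbered from `1`;
`f t` is the loss of round `t`, `E j t` is the prediction of base learner `j` in round `t`, and
`weight ζ f E t j` is the weight `v_t^{(j)}`, `1 ≤ j ≤ t`. (Round `0` does not exist; the weights
are `0` there, and also for `j` outside `{1, …, t}`.) -/
def weight (ζ : ℝ) (f : ℕ → ℝ → ℝ) (E : ℕ → ℕ → ℝ) : ℕ → ℕ → ℝ
  | 0 => fun _ => 0
  | 1 => fun i => if i = 1 then 1 else 0
  | t + 2 => fun i =>
      if i = t + 2 then 1 / ((t : ℝ) + 2)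
      else (1 - 1 / ((t : ℝ) + 2)) *
        (weight ζ f E (t + 1) i * Real.exp (-ζ * f (t + 1) (E i (t + 1))) /
          ∑ j ∈ Finset.Icc 1 (t + 1),
            weight ζ f E (t + 1) j * Real.exp (-ζ * f (t + 1) (E j (t + 1))))

/-- The prediction of Follow-the-Leading-History in round `t`. -/
def flh (ζ : ℝ) (f : ℕ → ℝ → ℝ) (E : ℕ → ℕ → ℝ) (t : ℕ) : ℝ :=
  ∑ j ∈ Finset.Icc 1 t, weight ζ f E t j * E j t

/-- The squared loss of round `t` for the label sequence `y`. -/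
def sqLoss (y : ℕ → ℝ) (t : ℕ) (x : ℝ) : ℝ := (y t - x) ^ 2

/-- Base learner `j`: projected OGD started in round `j` at the point `z j`, with step size
`1 / (2k)` in its `k`-th update. Meaningful for rounds `t ≥ j`. -/
def base (B : ℝ) (z y : ℕ → ℝ) (j t : ℕ) : ℝ :=
  ogd B (z j) (fun k => 1 / (2 * (k : ℝ))) (fun k => sqLoss y (j + k)) (t - j)

/-- The prediction in round `t` of FLH with learning rate `1 / (2 (G + B)²)` over the OGD base
learners. It depends only on `y 1, …, y (t - 1)` and on the initial points `z`. -/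
def predict (B G : ℝ) (z y : ℕ → ℝ) (t : ℕ) : ℝ :=
  flh (1 / (2 * (G + B) ^ 2)) (sqLoss y) (base B z y) t

/-- The total variation of `w 1, …, w n`. -/
def TV (n : ℕ) (w : ℕ → ℝ) : ℝ := ∑ t ∈ Finset.Icc 2 n, |w t - w (t - 1)|

/-- The comparator sequences in `[-B, B]` of total variation at most `C`. -/
def TVClass (B : ℝ) (n : ℕ) (C : ℝ) : Set (ℕ → ℝ) :=
  {w | TV n w ≤ C ∧ ∀ t ∈ Finset.Icc 1 n, |w t| ≤ B}

/-- The dynamic regret of the predictions `x` against the comparators `w` for squared losses. -/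
def regret (n : ℕ) (y x w : ℕ → ℝ) : ℝ :=
  ∑ t ∈ Finset.Icc 1 n, ((y t - x t) ^ 2 - (y t - w t) ^ 2)

end FLHOGD

end

/-!
# Dynamic regret of Follow-the-Leading-History over online gradient descent

The algorithm is strongly adaptive (`predict_interval_regret_le`): on every interval of rounds its
regret against every fixed point of `[-B, B]` is at most `R = 3 (G + B)² (1 + log n)`. Indeed the
square loss is exp-concave, so FLH loses little to the base learner started at the beginning of the
interval, which in turn has logarithmic regret because the square loss is strongly convex. Hence the
regret against a piecewise constant sequence is at most `R` times its number of pieces.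

It remains to compare an arbitrary `w` with a piecewise constant sequence having few pieces. Let `u`
minimize `∑ (y t - u t)² + 2 λ TV(u)` over the box. Quantize `u` with hysteresis to a grid of mesh
`r` that contains `±B`: the resulting `v` stays within distance `r` of `u`, moves by at least `r`
whenever it moves, moves only when `u` moves in the same direction, and equals `u` where `u` is on
the boundary. By the last two properties `u + ε (u - v)` is feasible for small `ε > 0` and its total
variation is affine in `ε`, so the minimality of `u` bounds the penalized objective of `v` by that
of `u` plus `∑ (u t - v t)² ≤ n r²` (`penalized_le_of_minimizer`). If `R ≤ 2 λ r`, the regret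
against `v` is at most `R + 2 λ TV(v)`, and this variation term is already part of the penalized
objective of `v`. Altogether (`dynamic_regret_le`)

  `regret(w) ≤ R + 2 λ TV(w) + n r²`.

With `T = max (n^{1/3} C^{2/3}) 1`, the choice `λ = R √(n / T)` and `r ≈ √(T / n)` makes the right
side `O(R T)`. No dual variables of the total variation constraint are needed: as `λ` is fixed in
advance, the variation of `u` is allowed to exceed `C`.
-/

namespace FLHOGD

open Finset Filter Topology

/-! ### Projected gradient descent -/

lemma proj_mem {B : ℝ} (hB : 0 ≤ B) (x : ℝ) : proj B x ∈ Set.Icc (-B) B :=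
  ⟨le_max_left _ _, max_le (by linarith) (min_le_left _ _)⟩

lemma proj_eq_self {B x : ℝ} (hx : x ∈ Set.Icc (-B) B) : proj B x = x := by
  rw [proj, min_eq_right hx.2, max_eq_right hx.1]

lemma sq_proj_sub_le {B p : ℝ} (hp : p ∈ Set.Icc (-B) B) (x : ℝ) :
    (proj B x - p) ^ 2 ≤ (x - p) ^ 2 := by
  obtain ⟨h1, h2⟩ := hp
  unfold proj
  rcases min_cases B x with ⟨h, h'⟩ | ⟨h, h'⟩ <;> rw [h]
  · rw [max_eq_right (by linarith)]
    nlinarith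
  · rcases max_cases (-B) x with ⟨h3, h4⟩ | ⟨h3, h4⟩ <;> rw [h3]
    nlinarith

lemma ogd_mem {B x₁ : ℝ} (hx : x₁ ∈ Set.Icc (-B) B) (η : ℕ → ℝ) (g : ℕ → ℝ → ℝ) (k : ℕ) :
    ogd B x₁ η g k ∈ Set.Icc (-B) B := by
  cases k with
  | zero => exact hx
  | succ k => exact proj_mem (by linarith [hx.1, hx.2]) _

lemma hasDerivAt_sqLoss (y : ℕ → ℝ) (t : ℕ) (x : ℝ) :
    HasDerivAt (sqLoss y t) (-2 * (y t - x)) x := by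
  have h : HasDerivAt (fun x : ℝ => (y t - x) ^ 2) ((2 : ℕ) * (y t - x) ^ (2 - 1) * (-1)) x :=
    ((hasDerivAt_id' x).const_sub (y t)).fun_pow 2
  have h' : -2 * (y t - x) = (2 : ℕ) * (y t - x) ^ (2 - 1) * (-1) := by norm_num
  rw [h']
  exact h

lemma deriv_sqLoss (y : ℕ → ℝ) (t : ℕ) (x : ℝ) : deriv (sqLoss y t) x = -2 * (y t - x) :=
  (hasDerivAt_sqLoss y t x).deriv

lemma sqLoss_le {B G : ℝ} {y : ℕ → ℝ} {t : ℕ} (hy : |y t| ≤ G) {x : ℝ}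
    (hx : x ∈ Set.Icc (-B) B) : sqLoss y t x ≤ (G + B) ^ 2 := by
  have := abs_le.mp hy
  exact sq_le_sq' (by linarith [hx.1, hx.2]) (by linarith [hx.1, hx.2])

lemma sum_inv_le_one_add_log {N n : ℕ} (h : N ≤ n) :
    ∑ k ∈ range N, 1 / ((k : ℝ) + 1) ≤ 1 + Real.log n := by
  have h1 : ∑ k ∈ range N, 1 / ((k : ℝ) + 1) ≤ ∑ k ∈ range n, 1 / ((k : ℝ) + 1) :=
    sum_le_sum_of_subset_of_nonneg (range_subset_range.mpr h) fun _ _ _ => by positivity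
  have h2 := harmonic_le_one_add_log n
  simp only [harmonic, Rat.cast_sum, Rat.cast_inv, Rat.cast_add, Rat.cast_natCast,
    Rat.cast_one, Nat.cast_add, Nat.cast_one] at h2
  simp only [one_div] at h1 ⊢
  exact h1.trans h2

/-- Static regret of OGD on quadratic losses. The term `N * (x_{N+1} - q)²` makes the induction
telescope: with step size `1 / (2k)`, strong convexity exactly cancels the change of step size. -/
lemma ogd_regret_add_le {B G : ℝ} {y : ℕ → ℝ} {x₁ q : ℝ} (hx : x₁ ∈ Set.Icc (-B) B)
    (hq : q ∈ Set.Icc (-B) B) (a N : ℕ) (hy : ∀ k < N, |y (a + k)| ≤ G) :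
    ∑ k ∈ range N, (sqLoss y (a + k)
        (ogd B x₁ (fun k => 1 / (2 * (k : ℝ))) (fun k => sqLoss y (a + k)) k)
          - sqLoss y (a + k) q)
      + N * (ogd B x₁ (fun k => 1 / (2 * (k : ℝ))) (fun k => sqLoss y (a + k)) N - q) ^ 2
      ≤ (G + B) ^ 2 * ∑ k ∈ range N, 1 / ((k : ℝ) + 1) := by
  induction N with
  | zero => simp
  | succ N ih =>
    have ih := ih fun k hk => hy k (by omega)
    rw [sum_range_succ, sum_range_succ, mul_add]
    set X := ogd B x₁ (fun k => 1 / (2 * (k : ℝ))) (fun k => sqLoss y (a + k)) N with hX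
    have hmem : X ∈ Set.Icc (-B) B := ogd_mem hx _ _ N
    have hstep : ogd B x₁ (fun k => 1 / (2 * (k : ℝ))) (fun k => sqLoss y (a + k)) (N + 1)
        = proj B (X + (y (a + N) - X) / ((N : ℝ) + 1)) := by
      rw [ogd, ← hX]
      simp only [deriv_sqLoss]
      congr 1
      push_cast
      field_simp
      ring
    rw [hstep]
    have hpr := sq_proj_sub_le hq (X + (y (a + N) - X) / ((N : ℝ) + 1))
    have hN : (0 : ℝ) < (N : ℝ) + 1 := by positivity
    have hl : (y (a + N) - X) ^ 2 ≤ (G + B) ^ 2 := sqLoss_le (hy N (by omega)) hmem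
    have hmul := mul_le_mul_of_nonneg_left hpr hN.le
    have hexp : ((N : ℝ) + 1) * (X + (y (a + N) - X) / ((N : ℝ) + 1) - q) ^ 2
        = (N + 1) * (X - q) ^ 2 + 2 * (y (a + N) - X) * (X - q)
          + (y (a + N) - X) ^ 2 * (1 / ((N : ℝ) + 1)) := by
      field_simp
      ring
    have hl' := mul_le_mul_of_nonneg_right hl (by positivity : (0 : ℝ) ≤ 1 / ((N : ℝ) + 1))
    simp only [sqLoss] at ih ⊢
    push_cast
    linarith

lemma base_mem {B : ℝ} {z : ℕ → ℝ} {j : ℕ} (hz : |z j| ≤ B) (y : ℕ → ℝ) (t : ℕ) :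
    base B z y j t ∈ Set.Icc (-B) B :=
  ogd_mem (abs_le.mp hz) _ _ _

lemma base_regret_le {B G : ℝ} {y z : ℕ → ℝ} {n a b : ℕ} {q : ℝ}
    (hy : ∀ t ∈ Icc 1 n, |y t| ≤ G) (ha : 1 ≤ a) (hb : b ≤ n) (hz : |z a| ≤ B)
    (hq : q ∈ Set.Icc (-B) B) :
    ∑ t ∈ Icc a b, (sqLoss y t (base B z y a t) - sqLoss y t q)
      ≤ (G + B) ^ 2 * (1 + Real.log n) := by
  have h := ogd_regret_add_le (G := G) (y := y) (x₁ := z a) (abs_le.mp hz) hq a (b + 1 - a)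
    fun k hk => hy _ (mem_Icc.mpr ⟨by omega, by omega⟩)
  have hI : Icc a b = Ico a (b + 1) := by ext; simp
  rw [hI, sum_Ico_eq_sum_range]
  simp only [base, add_tsub_cancel_left]
  have h1 := mul_le_mul_of_nonneg_left (sum_inv_le_one_add_log (show b + 1 - a ≤ n by omega))
    (sq_nonneg (G + B))
  have h2 : 0 ≤ ((b + 1 - a : ℕ) : ℝ) * (ogd B (z a) (fun k => 1 / (2 * (k : ℝ)))
    (fun k => sqLoss y (a + k)) (b + 1 - a) - q) ^ 2 := by positivity
  linarith

/-! ### Aggregation by Follow-the-Leading-History -/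

section Aggregation

variable {ζ : ℝ} {f : ℕ → ℝ → ℝ} {E : ℕ → ℕ → ℝ}

lemma weight_sum_pos_and_pos (t : ℕ) :
    (∀ j ∈ Icc 1 (t + 1), 0 < weight ζ f E (t + 1) j) ∧
      ∑ j ∈ Icc 1 (t + 1), weight ζ f E (t + 1) j = 1 := by
  induction t with
  | zero =>
    constructor
    · intro j hj
      have : j = 1 := by simpa using hj
      simp [weight, this]
    · simp [weight]
  | succ t ih =>
    obtain ⟨ih1, ih2⟩ := ih
    have hW : 0 < ∑ j ∈ Icc 1 (t + 1),
        weight ζ f E (t + 1) j * Real.exp (-ζ * f (t + 1) (E j (t + 1))) :=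
      sum_pos (fun j hj => mul_pos (ih1 j hj) (Real.exp_pos _)) ⟨1, by simp⟩
    have ht : (0 : ℝ) < 1 - 1 / ((t : ℝ) + 2) := by
      rw [sub_pos, div_lt_one (by positivity)]
      linarith [(Nat.cast_nonneg t : (0 : ℝ) ≤ t)]
    constructor
    · intro j hj
      rw [mem_Icc] at hj
      by_cases h : j = t + 2
      · simp only [weight, h, if_true]
        positivity
      · simp only [weight, h, if_false]
        exact mul_pos ht (div_pos (mul_pos (ih1 j (mem_Icc.mpr ⟨hj.1, by omega⟩))
          (Real.exp_pos _)) hW)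
    · rw [sum_Icc_succ_top (by omega)]
      have h1 : ∑ j ∈ Icc 1 (t + 1), weight ζ f E (t + 1 + 1) j = 1 - 1 / ((t : ℝ) + 2) := by
        have h2 : ∀ j ∈ Icc 1 (t + 1), weight ζ f E (t + 1 + 1) j
            = (1 - 1 / ((t : ℝ) + 2)) *
              (weight ζ f E (t + 1) j * Real.exp (-ζ * f (t + 1) (E j (t + 1))) /
                ∑ j ∈ Icc 1 (t + 1),
                  weight ζ f E (t + 1) j * Real.exp (-ζ * f (t + 1) (E j (t + 1)))) := by
          intro j hj
          rw [mem_Icc] at hj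
          simp only [weight, show j ≠ t + 2 by omega, if_false]
        rw [sum_congr rfl h2, ← mul_sum, ← sum_div, div_self hW.ne', mul_one]
      rw [h1]
      simp [weight]

lemma weight_pos {t j : ℕ} (hj : j ∈ Icc 1 t) : 0 < weight ζ f E t j := by
  obtain ⟨s, rfl⟩ : ∃ s, t = s + 1 := ⟨t - 1, by rw [mem_Icc] at hj; omega⟩
  exact (weight_sum_pos_and_pos s).1 j hj

lemma weight_sum {t : ℕ} (ht : 1 ≤ t) : ∑ j ∈ Icc 1 t, weight ζ f E t j = 1 := by
  obtain ⟨s, rfl⟩ : ∃ s, t = s + 1 := ⟨t - 1, by omega⟩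
  exact (weight_sum_pos_and_pos s).2

lemma weight_self {t : ℕ} (ht : 1 ≤ t) : weight ζ f E t t = 1 / (t : ℝ) := by
  obtain ⟨s, rfl⟩ : ∃ s, t = s + 1 := ⟨t - 1, by omega⟩
  cases s with
  | zero => simp [weight]
  | succ s =>
    simp only [weight, if_true]
    push_cast
    ring

lemma weight_le_one {t j : ℕ} (hj : j ∈ Icc 1 t) : weight ζ f E t j ≤ 1 := by
  rw [← weight_sum (ζ := ζ) (f := f) (E := E) (show 1 ≤ t by rw [mem_Icc] at hj; omega)]
  exact single_le_sum (fun i hi => (weight_pos hi).le) hj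

lemma flh_mem {B : ℝ} {t : ℕ} (ht : 1 ≤ t)
    (hE : ∀ j ∈ Icc 1 t, E j t ∈ Set.Icc (-B) B) : flh ζ f E t ∈ Set.Icc (-B) B := by
  have := (convex_Icc (-B) B).sum_mem (t := Icc 1 t) (w := weight ζ f E t) (z := fun j => E j t)
    (fun i hi => (weight_pos hi).le) (weight_sum ht) hE
  simpa [flh] using this

/-- One round of FLH: for an exp-concave loss, the instantaneous regret against learner `j` is
paid for by the growth of the log-weight of `j`, up to the mixing factor `t / (t + 1)`. -/
lemma flh_round_le {t j : ℕ} (hj : j ∈ Icc 1 t) {s : Set ℝ}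
    (hconc : ConcaveOn ℝ s fun x => Real.exp (-ζ * f t x)) (hE : ∀ i ∈ Icc 1 t, E i t ∈ s) :
    ζ * (f t (flh ζ f E t) - f t (E j t)) ≤
      Real.log (weight ζ f E (t + 1) j) - Real.log (weight ζ f E t j)
        + (Real.log ((t + 1 : ℕ) : ℝ) - Real.log t) := by
  have hjt := mem_Icc.mp hj
  obtain ⟨k, rfl⟩ : ∃ k, t = k + 1 := ⟨t - 1, by omega⟩
  set W := ∑ i ∈ Icc 1 (k + 1), weight ζ f E (k + 1) i * Real.exp (-ζ * f (k + 1) (E i (k + 1)))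
    with hWdef
  have hW : 0 < W := sum_pos (fun i hi => mul_pos (weight_pos hi) (Real.exp_pos _)) ⟨j, hj⟩
  have hjensen : W ≤ Real.exp (-ζ * f (k + 1) (flh ζ f E (k + 1))) := by
    have := hconc.le_map_sum (t := Icc 1 (k + 1)) (w := weight ζ f E (k + 1))
      (p := fun i => E i (k + 1)) (fun i hi => (weight_pos hi).le) (weight_sum (by omega)) hE
    simpa [flh, hWdef] using this
  have hlogW : Real.log W ≤ -ζ * f (k + 1) (flh ζ f E (k + 1)) := by
    rw [← Real.log_exp (-ζ * f (k + 1) (flh ζ f E (k + 1)))]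
    exact Real.log_le_log hW hjensen
  have hk : (1 : ℝ) - 1 / ((k : ℝ) + 2) = ((k + 1 : ℕ) : ℝ) / ((k + 1 + 1 : ℕ) : ℝ) := by
    push_cast
    field_simp
    ring
  have hw : weight ζ f E (k + 1 + 1) j = (((k + 1 : ℕ) : ℝ) / ((k + 1 + 1 : ℕ) : ℝ)) *
      (weight ζ f E (k + 1) j * Real.exp (-ζ * f (k + 1) (E j (k + 1))) / W) := by
    rw [← hk]
    simp only [weight, show j ≠ k + 2 by omega, if_false, hWdef]
  have hwj : 0 < weight ζ f E (k + 1) j := weight_pos hj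
  rw [hw, Real.log_mul (by positivity) (by positivity), Real.log_div (by positivity) hW.ne',
    Real.log_mul hwj.ne' (Real.exp_pos _).ne', Real.log_exp,
    Real.log_div (by positivity) (by positivity)]
  linarith

lemma flh_regret_le {s : Set ℝ} {n a : ℕ} (ha : 1 ≤ a)
    (hconc : ∀ t ∈ Icc 1 n, ConcaveOn ℝ s fun x => Real.exp (-ζ * f t x))
    (hE : ∀ t ∈ Icc 1 n, ∀ i ∈ Icc 1 t, E i t ∈ s) {b : ℕ} (hab : a ≤ b) (hb : b ≤ n) :
    ζ * ∑ t ∈ Icc a b, (f t (flh ζ f E t) - f t (E a t)) ≤ Real.log ((b + 1 : ℕ) : ℝ) := by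
  have key : ζ * ∑ t ∈ Icc a b, (f t (flh ζ f E t) - f t (E a t)) ≤
      Real.log (weight ζ f E (b + 1) a) - Real.log (weight ζ f E a a)
        + (Real.log ((b + 1 : ℕ) : ℝ) - Real.log a) := by
    rw [mul_sum]
    have hI : Icc a b = Ico a (b + 1) := by ext; simp
    have h1 := sum_Ico_sub (fun t => Real.log (weight ζ f E t a)) (show a ≤ b + 1 by omega)
    have h2 := sum_Ico_sub (fun t : ℕ => Real.log (t : ℝ)) (show a ≤ b + 1 by omega)
    rw [hI, ← h1, ← h2, ← sum_add_distrib]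
    refine sum_le_sum fun t ht => ?_
    rw [mem_Ico] at ht
    have htn : t ∈ Icc 1 n := mem_Icc.mpr ⟨by omega, by omega⟩
    exact flh_round_le (mem_Icc.mpr ⟨ha, ht.1⟩) (hconc t htn) (hE t htn)
  have h3 : Real.log (weight ζ f E (b + 1) a) ≤ 0 :=
    Real.log_nonpos (weight_pos (mem_Icc.mpr ⟨ha, by omega⟩)).le
      (weight_le_one (mem_Icc.mpr ⟨ha, by omega⟩))
  rw [weight_self ha, one_div, Real.log_inv] at key
  linarith

end Aggregation

/-- The square loss is exp-concave: `exp (-ζ u²)` is concave where `2 ζ u² ≤ 1`. -/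
lemma concaveOn_exp_neg_sqLoss {B G : ℝ} (hG : 0 < G + B) {y : ℕ → ℝ} {t : ℕ} (hy : |y t| ≤ G) :
    ConcaveOn ℝ (Set.Icc (-B) B)
      fun x => Real.exp (-(1 / (2 * (G + B) ^ 2)) * sqLoss y t x) := by
  set ζ := 1 / (2 * (G + B) ^ 2) with hζ
  have h1 : ∀ x, HasDerivAt (fun x => Real.exp (-ζ * sqLoss y t x))
      (Real.exp (-ζ * sqLoss y t x) * (2 * ζ * (y t - x))) x := by
    intro x
    convert ((hasDerivAt_sqLoss y t x).const_mul (-ζ)).exp using 1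
    ring
  have h2 : ∀ x, HasDerivAt (fun x => Real.exp (-ζ * sqLoss y t x) * (2 * ζ * (y t - x)))
      (Real.exp (-ζ * sqLoss y t x) * (2 * ζ * (y t - x)) * (2 * ζ * (y t - x))
        + Real.exp (-ζ * sqLoss y t x) * (2 * ζ * (-1))) x := by
    intro x
    exact (h1 x).fun_mul (((hasDerivAt_id' x).const_sub (y t)).const_mul (2 * ζ))
  refine concaveOn_of_hasDerivWithinAt2_nonpos (convex_Icc _ _)
    (fun x _ => (h1 x).continuousAt.continuousWithinAt)
    (fun x _ => (h1 x).hasDerivWithinAt) (fun x _ => (h2 x).hasDerivWithinAt) fun x hx => ?_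
  have hl := sqLoss_le hy (interior_subset hx)
  have hb : 2 * ζ * (y t - x) ^ 2 ≤ 1 := by
    rw [hζ]
    have : 2 * (1 / (2 * (G + B) ^ 2)) * (y t - x) ^ 2 = (y t - x) ^ 2 / (G + B) ^ 2 := by
      field_simp
    rw [this]
    exact (div_le_one (by positivity)).mpr hl
  have hζ0 : 0 < ζ := by positivity
  have : Real.exp (-ζ * sqLoss y t x) * (2 * ζ * (y t - x)) * (2 * ζ * (y t - x))
        + Real.exp (-ζ * sqLoss y t x) * (2 * ζ * (-1))
      = Real.exp (-ζ * sqLoss y t x) * (2 * ζ) * (2 * ζ * (y t - x) ^ 2 - 1) := by ring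
  rw [this]
  exact mul_nonpos_of_nonneg_of_nonpos (by positivity) (by linarith)

lemma predict_mem {B : ℝ} {y z : ℕ → ℝ} {n : ℕ} (hz : ∀ j ∈ Icc 1 n, |z j| ≤ B) (G : ℝ)
    {t : ℕ} (ht : t ∈ Icc 1 n) : predict B G z y t ∈ Set.Icc (-B) B := by
  rw [mem_Icc] at ht
  refine flh_mem ht.1 fun j hj => ?_
  rw [mem_Icc] at hj
  exact base_mem (hz j (mem_Icc.mpr ⟨hj.1, by omega⟩)) _ _

/-- Strongly adaptive regret: on every interval, FLH over OGD has logarithmic regret against every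
fixed point. -/
lemma predict_interval_regret_le {B G : ℝ} (hG : 0 < G + B) {y z : ℕ → ℝ} {n : ℕ}
    (hy : ∀ t ∈ Icc 1 n, |y t| ≤ G) (hz : ∀ j ∈ Icc 1 n, |z j| ≤ B) {a b : ℕ} (ha : 1 ≤ a)
    (hab : a ≤ b) (hb : b ≤ n) {q : ℝ} (hq : q ∈ Set.Icc (-B) B) :
    ∑ t ∈ Icc a b, (sqLoss y t (predict B G z y t) - sqLoss y t q)
      ≤ 3 * (G + B) ^ 2 * (1 + Real.log n) := by
  have h1 := base_regret_le hy ha hb (hz a (mem_Icc.mpr ⟨ha, by omega⟩)) hq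
  have h2 := flh_regret_le (ζ := 1 / (2 * (G + B) ^ 2)) (f := sqLoss y) (E := base B z y)
    (s := Set.Icc (-B) B) (n := n) ha
    (fun t ht => concaveOn_exp_neg_sqLoss hG (hy t ht))
    (fun t ht i hi => base_mem (hz i (by simp only [mem_Icc] at *; omega)) _ _) hab hb
  have hlog : Real.log ((b + 1 : ℕ) : ℝ) ≤ 1 + Real.log n := by
    have hn : (1 : ℝ) ≤ n := by exact_mod_cast (by omega : 1 ≤ n)
    have hb' : ((b + 1 : ℕ) : ℝ) ≤ 2 * n := by exact_mod_cast (by omega : b + 1 ≤ 2 * n)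
    calc Real.log ((b + 1 : ℕ) : ℝ) ≤ Real.log (2 * n) := Real.log_le_log (by positivity) hb'
      _ = Real.log 2 + Real.log n := Real.log_mul (by norm_num) (by positivity)
      _ ≤ 1 + Real.log n := by linarith [Real.log_two_lt_d9]
  have h3 := h2.trans hlog
  rw [one_div, inv_mul_le_iff₀ (by positivity)] at h3
  have h4 : ∑ t ∈ Icc a b, (sqLoss y t (predict B G z y t) - sqLoss y t q)
      = ∑ t ∈ Icc a b, (sqLoss y t (flh (1 / (2 * (G + B) ^ 2)) (sqLoss y) (base B z y) t)
          - sqLoss y t (base B z y a t))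
        + ∑ t ∈ Icc a b, (sqLoss y t (base B z y a t) - sqLoss y t q) := by
    rw [← sum_add_distrib]
    exact sum_congr rfl fun t _ => by simp only [predict]; ring
  rw [h4]
  simp only [one_div] at h3 ⊢
  linarith

/-! ### The total-variation penalized least squares problem -/

lemma TV_nonneg (n : ℕ) (w : ℕ → ℝ) : 0 ≤ TV n w := sum_nonneg fun _ _ => abs_nonneg _

lemma TV_succ {N : ℕ} (hN : 1 ≤ N) (v : ℕ → ℝ) : TV (N + 1) v = TV N v + |v (N + 1) - v N| := by
  rw [TV, TV, sum_Icc_succ_top (by omega), Nat.add_sub_cancel]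

/-- The least squares objective with total variation penalty `2 * lam * TV`. -/
noncomputable def penalized (lam : ℝ) (n : ℕ) (y w : ℕ → ℝ) : ℝ :=
  ∑ t ∈ Icc 1 n, sqLoss y t (w t) + 2 * lam * TV n w

/-- A minimizer of the penalized objective over the box exists by compactness. Its values outside
rounds `1, …, n` do not enter the objective, but are kept in the box as well. -/
lemma exists_minimizer {B : ℝ} (hB : 0 ≤ B) (lam : ℝ) (n : ℕ) (y : ℕ → ℝ) :
    ∃ u : ℕ → ℝ, (∀ t, u t ∈ Set.Icc (-B) B) ∧
      ∀ w : ℕ → ℝ, (∀ t ∈ Icc 1 n, w t ∈ Set.Icc (-B) B) →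
        penalized lam n y u ≤ penalized lam n y w := by
  have hcomp : IsCompact (Set.univ.pi fun _ : ℕ => Set.Icc (-B) B) :=
    isCompact_univ_pi fun _ => isCompact_Icc
  have hcont : Continuous (penalized lam n y) := by
    unfold penalized TV sqLoss
    fun_prop
  obtain ⟨u, hu, hmin⟩ := hcomp.exists_isMinOn
    ⟨fun _ => 0, fun _ _ => ⟨by linarith, hB⟩⟩ hcont.continuousOn
  refine ⟨u, fun t => hu t trivial, fun w hw => ?_⟩
  have h1 := hmin (show (fun t => proj B (w t)) ∈ _ from fun t _ => proj_mem hB (w t))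
  have h2 : penalized lam n y (fun t => proj B (w t)) = penalized lam n y w := by
    have hp : ∀ t ∈ Icc 1 n, proj B (w t) = w t := fun t ht => proj_eq_self (hw t ht)
    unfold penalized TV
    congr 1
    · exact sum_congr rfl fun t ht => by simp only [hp t ht]
    · congr 1
      refine sum_congr rfl fun t ht => ?_
      rw [mem_Icc] at ht
      simp only [hp t (mem_Icc.mpr ⟨by omega, by omega⟩),
        hp (t - 1) (mem_Icc.mpr ⟨by omega, by omega⟩)]
  simpa [h2] using h1

/-- Moving by a small multiple of `d` keeps the sign of a nonzero increment `a`, so the absolute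
value is linear along the move if `d = 0` or `a` and `d` have the same sign. -/
lemma eventually_abs_add_eq {a d : ℝ} (h : d = 0 ∨ (0 < d ∧ 0 < a) ∨ (d < 0 ∧ a < 0)) :
    ∀ᶠ ε in 𝓝[>] (0 : ℝ), |a + ε * (a - d)| = |a| + ε * (|a| - |d|) := by
  have hlim : Tendsto (fun ε : ℝ => a + ε * (a - d)) (𝓝[>] 0) (𝓝 a) := by
    have : Continuous fun ε : ℝ => a + ε * (a - d) := by fun_prop
    simpa using (this.tendsto 0).mono_left nhdsWithin_le_nhds
  rcases h with rfl | ⟨hd, ha⟩ | ⟨hd, ha⟩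
  · filter_upwards [self_mem_nhdsWithin] with ε hε
    have hε : (0 : ℝ) < ε := hε
    rw [show a + ε * (a - 0) = (1 + ε) * a by ring, abs_mul, abs_of_pos (by linarith : 0 < 1 + ε),
      abs_zero]
    ring
  · filter_upwards [hlim.eventually (lt_mem_nhds ha)] with ε hε
    rw [abs_of_pos hε, abs_of_pos ha, abs_of_pos hd]
  · filter_upwards [hlim.eventually (gt_mem_nhds ha)] with ε hε
    rw [abs_of_neg hε, abs_of_neg ha, abs_of_neg hd]
    ring

/-- If `v` agrees with the minimizer `u` where `u` is on the boundary of the box, and `v` only moves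
when `u` moves in the same direction, then replacing `u` by `v` raises the penalized objective by
at most `∑ (u t - v t)²`. Indeed `u + ε (u - v)` is then feasible for small `ε > 0`, and the total
variation is affine in `ε` there, so the first-order change in the direction `v - u` is `≤ 0`. -/
lemma penalized_le_of_minimizer {B lam : ℝ} {n : ℕ} {y u v : ℕ → ℝ}
    (hu : ∀ t, u t ∈ Set.Icc (-B) B)
    (hmin : ∀ w : ℕ → ℝ, (∀ t ∈ Icc 1 n, w t ∈ Set.Icc (-B) B) →
      penalized lam n y u ≤ penalized lam n y w)
    (hbd : ∀ t ∈ Icc 1 n, u t = -B ∨ u t = B → v t = u t)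
    (hjump : ∀ t ∈ Icc 2 n, v t = v (t - 1) ∨ (v (t - 1) < v t ∧ u (t - 1) < u t) ∨
      (v t < v (t - 1) ∧ u t < u (t - 1))) :
    penalized lam n y v ≤ penalized lam n y u + ∑ t ∈ Icc 1 n, (u t - v t) ^ 2 := by
  set S := ∑ t ∈ Icc 1 n, (u t - v t) ^ 2 with hS
  set A := ∑ t ∈ Icc 1 n, 2 * (u t - v t) * (u t - y t) + 2 * lam * (TV n u - TV n v) with hA
  have hbox : ∀ᶠ ε in 𝓝[>] (0 : ℝ), ∀ t ∈ Icc 1 n,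
      u t + ε * (u t - v t) ∈ Set.Icc (-B) B := by
    rw [eventually_all_finset]
    intro t ht
    by_cases h : u t = -B ∨ u t = B
    · simp [hbd t ht h, hu t]
    · push Not at h
      have hlim : Tendsto (fun ε : ℝ => u t + ε * (u t - v t)) (𝓝[>] 0) (𝓝 (u t)) := by
        have : Continuous fun ε : ℝ => u t + ε * (u t - v t) := by fun_prop
        simpa using (this.tendsto 0).mono_left nhdsWithin_le_nhds
      exact hlim.eventually (Icc_mem_nhds (lt_of_le_of_ne (hu t).1 (Ne.symm h.1))
        (lt_of_le_of_ne (hu t).2 h.2))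
  have htv : ∀ᶠ ε in 𝓝[>] (0 : ℝ), ∀ t ∈ Icc 2 n,
      |(u t - u (t - 1)) + ε * ((u t - u (t - 1)) - (v t - v (t - 1)))| =
        |u t - u (t - 1)| + ε * (|u t - u (t - 1)| - |v t - v (t - 1)|) := by
    rw [eventually_all_finset]
    intro t ht
    refine eventually_abs_add_eq ?_
    rcases hjump t ht with h | ⟨h1, h2⟩ | ⟨h1, h2⟩
    · exact Or.inl (sub_eq_zero.mpr h)
    · exact Or.inr (Or.inl ⟨sub_pos.mpr h1, sub_pos.mpr h2⟩)
    · exact Or.inr (Or.inr ⟨sub_neg.mpr h1, sub_neg.mpr h2⟩)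
  have hfirst : ∀ᶠ ε in 𝓝[>] (0 : ℝ), 0 ≤ A + ε * S := by
    filter_upwards [hbox, htv, self_mem_nhdsWithin] with ε h1 h2 hε
    have hε : (0 : ℝ) < ε := hε
    have h3 := hmin (fun t => u t + ε * (u t - v t)) h1
    have h4 : TV n (fun t => u t + ε * (u t - v t)) = TV n u + ε * (TV n u - TV n v) := by
      unfold TV
      rw [← sum_sub_distrib, mul_sum, ← sum_add_distrib]
      refine sum_congr rfl fun t ht => ?_
      rw [← h2 t ht]
      congr 1
      ring
    have h5 : ∑ t ∈ Icc 1 n, sqLoss y t (u t + ε * (u t - v t)) =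
        ∑ t ∈ Icc 1 n, sqLoss y t (u t)
          + ε * (∑ t ∈ Icc 1 n, 2 * (u t - v t) * (u t - y t) + ε * S) := by
      rw [hS, mul_sum, ← sum_add_distrib, mul_sum, ← sum_add_distrib]
      refine sum_congr rfl fun t _ => ?_
      simp only [sqLoss]
      ring
    unfold penalized at h3
    rw [h4, h5] at h3
    have h6 : 0 ≤ ε * (A + ε * S) := by
      rw [hA]
      linarith
    exact nonneg_of_mul_nonneg_right h6 hε
  have hA0 : 0 ≤ A := by
    have hlim : Tendsto (fun ε : ℝ => A + ε * S) (𝓝[>] 0) (𝓝 A) := by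
      have : Continuous fun ε : ℝ => A + ε * S := by fun_prop
      simpa using (this.tendsto 0).mono_left nhdsWithin_le_nhds
    exact ge_of_tendsto hlim hfirst
  have hv : ∑ t ∈ Icc 1 n, sqLoss y t (v t) = ∑ t ∈ Icc 1 n, sqLoss y t (u t)
      - ∑ t ∈ Icc 1 n, 2 * (u t - v t) * (u t - y t) + S := by
    rw [hS, ← sum_sub_distrib, ← sum_add_distrib]
    refine sum_congr rfl fun t _ => ?_
    simp only [sqLoss]
    ring
  unfold penalized
  rw [hv]
  linarith

/-! ### Quantization with hysteresis -/

/-- Integer quantization of `U` with hysteresis: the value is kept until `U` has moved away from it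
by at least `1`, and is then replaced by the last integer that `U` has reached on its way. -/
noncomputable def hysteresis (U : ℕ → ℝ) : ℕ → ℤ
  | 0 => ⌊U 0⌋
  | t + 1 =>
    if (hysteresis U t : ℝ) + 1 ≤ U (t + 1) then ⌊U (t + 1)⌋
    else if U (t + 1) ≤ hysteresis U t - 1 then ⌈U (t + 1)⌉
    else hysteresis U t

lemma abs_sub_hysteresis_lt (U : ℕ → ℝ) (t : ℕ) : |U t - hysteresis U t| < 1 := by
  rw [abs_lt]
  cases t with
  | zero =>
    rw [hysteresis]
    constructor <;> linarith [Int.floor_le (U 0), Int.lt_floor_add_one (U 0)]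
  | succ t =>
    rw [hysteresis]
    split_ifs with h1 h2
    · constructor <;> linarith [Int.floor_le (U (t + 1)), Int.lt_floor_add_one (U (t + 1))]
    · constructor <;> linarith [Int.le_ceil (U (t + 1)), Int.ceil_lt_add_one (U (t + 1))]
    · push Not at h1 h2
      constructor <;> linarith

lemma hysteresis_eq_of_eq_intCast {U : ℕ → ℝ} {t : ℕ} {z : ℤ} (h : U t = z) :
    hysteresis U t = z := by
  have := abs_sub_hysteresis_lt U t
  rw [h, ← Int.cast_sub, ← Int.cast_abs] at this
  have h' : |z - hysteresis U t| < 1 := by exact_mod_cast this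
  have := Int.abs_lt_one_iff.mp h'
  omega

lemma hysteresis_mem {U : ℕ → ℝ} {t : ℕ} {m : ℕ} (h : U t ∈ Set.Icc (0 : ℝ) m) :
    (hysteresis U t : ℝ) ∈ Set.Icc (0 : ℝ) m := by
  have := abs_lt.mp (abs_sub_hysteresis_lt U t)
  have h1 : ((-1 : ℤ) : ℝ) < hysteresis U t := by push_cast; linarith [h.1]
  have h2 : (hysteresis U t : ℝ) < ((m + 1 : ℤ) : ℝ) := by push_cast; linarith [h.2]
  have h1' := Int.cast_lt.mp h1
  have h2' := Int.cast_lt.mp h2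
  constructor
  · exact_mod_cast (by omega : 0 ≤ hysteresis U t)
  · exact_mod_cast (by omega : hysteresis U t ≤ m)

lemma hysteresis_succ (U : ℕ → ℝ) (t : ℕ) :
    hysteresis U (t + 1) = hysteresis U t ∨
      ((hysteresis U t : ℝ) + 1 ≤ hysteresis U (t + 1) ∧ U t < U (t + 1)) ∨
      ((hysteresis U (t + 1) : ℝ) ≤ hysteresis U t - 1 ∧ U (t + 1) < U t) := by
  have := abs_lt.mp (abs_sub_hysteresis_lt U t)
  rw [hysteresis]
  split_ifs with h1 h2
  · refine Or.inr (Or.inl ⟨?_, by linarith⟩)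
    exact_mod_cast Int.le_floor.mpr (by exact_mod_cast h1 : ((hysteresis U t + 1 : ℤ) : ℝ) ≤ _)
  · refine Or.inr (Or.inr ⟨?_, by linarith⟩)
    exact_mod_cast Int.ceil_le.mpr (by exact_mod_cast h2 : _ ≤ ((hysteresis U t - 1 : ℤ) : ℝ))
  · exact Or.inl rfl

/-- A path in `[-B, B]` is followed within distance `r = 2B / m` by a path `v` on the grid
`-B + r ℤ` that moves by at least `r` if it moves, and only together with `u`. As `±B` are grid
points, `v` agrees with `u` where `u` is on the boundary. -/
lemma exists_quantization {B : ℝ} (hB : 0 < B) {m : ℕ} (hm : 1 ≤ m) {u : ℕ → ℝ}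
    (hu : ∀ t, u t ∈ Set.Icc (-B) B) :
    ∃ v : ℕ → ℝ, (∀ t, v t ∈ Set.Icc (-B) B) ∧ (∀ t, (u t - v t) ^ 2 ≤ (2 * B / m) ^ 2) ∧
      (∀ t, u t = -B ∨ u t = B → v t = u t) ∧
      ∀ t, v (t + 1) = v t ∨ (v t + 2 * B / m ≤ v (t + 1) ∧ u t < u (t + 1)) ∨
        (v (t + 1) ≤ v t - 2 * B / m ∧ u (t + 1) < u t) := by
  have hm0 : (0 : ℝ) < m := by exact_mod_cast hm
  set r := 2 * B / m with hr
  have hr0 : 0 < r := by positivity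
  have hrm : r * m = 2 * B := by rw [hr]; field_simp
  set U : ℕ → ℝ := fun t => (u t + B) / r with hU
  have huU : ∀ t, u t = -B + r * U t := fun t => by
    simp only [hU]
    field_simp
    ring
  have hUmem : ∀ t, U t ∈ Set.Icc (0 : ℝ) m := fun t => by
    constructor
    · exact div_nonneg (by linarith [(hu t).1]) hr0.le
    · rw [hU, div_le_iff₀ hr0]
      linarith [(hu t).2]
  refine ⟨fun t => -B + r * hysteresis U t, fun t => ?_, fun t => ?_, fun t ht => ?_,
    fun t => ?_⟩
  · obtain ⟨h1, h2⟩ := hysteresis_mem (hUmem t)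
    have h3 := mul_le_mul_of_nonneg_left h2 hr0.le
    have h4 := mul_nonneg hr0.le h1
    constructor <;> linarith
  · have h := abs_sub_hysteresis_lt U t
    rw [huU t, show -B + r * U t - (-B + r * hysteresis U t) = r * (U t - hysteresis U t) by ring,
      mul_pow]
    have : (U t - hysteresis U t) ^ 2 ≤ 1 := (sq_le_one_iff_abs_le_one _).mpr h.le
    nlinarith [sq_nonneg r]
  · have : ∃ z : ℤ, U t = z := by
      rcases ht with h | h
      · exact ⟨0, by simp [hU, h]⟩
      · refine ⟨m, ?_⟩
        simp only [hU, h, Int.cast_natCast]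
        rw [div_eq_iff hr0.ne']
        linarith
    obtain ⟨z, hz⟩ := this
    simp only [huU t, hysteresis_eq_of_eq_intCast hz, hz]
  · have hlt : ∀ s s', U s < U s' → u s < u s' := fun s s' h => by
      rw [huU s, huU s']
      linarith [mul_lt_mul_of_pos_left h hr0]
    rcases hysteresis_succ U t with h | ⟨h1, h2⟩ | ⟨h1, h2⟩
    · exact Or.inl (by simp only [h])
    · have := mul_le_mul_of_nonneg_left h1 hr0.le
      exact Or.inr (Or.inl ⟨by linarith, hlt _ _ h2⟩)
    · have := mul_le_mul_of_nonneg_left h1 hr0.le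
      exact Or.inr (Or.inr ⟨by linarith, hlt _ _ h2⟩)

/-! ### From static to dynamic regret -/

/-- If the regret against a fixed point is at most `R` on every interval, then the regret against a
piecewise constant `v` is at most `R` plus `R` per jump, which the variation of `v` pays for if each
jump has size at least `r` with `R ≤ c * r`. -/
lemma piecewise_regret_le {s : Set ℝ} {f : ℕ → ℝ → ℝ} {x v : ℕ → ℝ} {n : ℕ}
    {R c r : ℝ} (hR : ∀ a b, 1 ≤ a → a ≤ b → b ≤ n → ∀ q ∈ s,
      ∑ t ∈ Icc a b, (f t (x t) - f t q) ≤ R)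
    (hc : 0 ≤ c) (hRr : R ≤ c * r) (hv : ∀ t, v t ∈ s)
    (hjump : ∀ t, v (t + 1) = v t ∨ r ≤ |v (t + 1) - v t|) (hn : 1 ≤ n) :
    ∑ t ∈ Icc 1 n, (f t (x t) - f t (v t)) ≤ R + c * TV n v := by
  -- `[a, N]` is the last piece on which `v` is constant
  have key : ∀ N, 1 ≤ N → N ≤ n → ∃ a, 1 ≤ a ∧ a ≤ N ∧ (∀ t ∈ Icc a N, v t = v N) ∧
      ∑ t ∈ Ico 1 a, (f t (x t) - f t (v t)) ≤ c * TV N v := by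
    intro N hN
    induction N, hN using Nat.le_induction with
    | base =>
      intro _
      refine ⟨1, le_rfl, le_rfl, fun t ht => ?_, ?_⟩
      · rw [show t = 1 by simpa using ht]
      · simpa using mul_nonneg hc (TV_nonneg 1 v)
    | succ N hN ih =>
      intro hNn
      obtain ⟨a, ha1, haN, hconst, hsum⟩ := ih (by omega)
      rw [TV_succ hN, mul_add]
      rcases hjump N with h | h
      · refine ⟨a, ha1, by omega, fun t ht => ?_, ?_⟩
        · rw [mem_Icc] at ht
          rcases Nat.lt_or_ge N t with h' | h'
          · rw [show t = N + 1 by omega]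
          · rw [h, hconst t (mem_Icc.mpr ⟨ht.1, h'⟩)]
        · linarith [mul_nonneg hc (abs_nonneg (v (N + 1) - v N))]
      · refine ⟨N + 1, by omega, le_rfl, fun t ht => ?_, ?_⟩
        · rw [show t = N + 1 by simpa using ht]
        · have h1 : ∑ t ∈ Icc a N, (f t (x t) - f t (v t)) ≤ R := by
            rw [sum_congr rfl fun t ht => by rw [hconst t ht]]
            exact hR a N ha1 haN (by omega) _ (hv N)
          have hI : Icc a N = Ico a (N + 1) := by ext; simp
          rw [hI] at h1
          rw [← sum_Ico_consecutive _ ha1 (show a ≤ N + 1 by omega)]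
          linarith [mul_le_mul_of_nonneg_left h hc]
  obtain ⟨a, ha1, han, hconst, hsum⟩ := key n hn le_rfl
  have h1 : ∑ t ∈ Icc a n, (f t (x t) - f t (v t)) ≤ R := by
    rw [sum_congr rfl fun t ht => by rw [hconst t ht]]
    exact hR a n ha1 han le_rfl _ (hv n)
  have hI : ∀ k, Icc k n = Ico k (n + 1) := fun k => by ext; simp
  rw [hI] at h1 ⊢
  rw [← sum_Ico_consecutive _ ha1 (show a ≤ n + 1 by omega)]
  linarith

/-- Dynamic regret in terms of the static regret `R` on intervals: for every scale `m` and every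
penalty `lam` with `R ≤ 2 * lam * (2 * B / m)`, the penalized minimizer, quantized to the grid of
mesh `2 * B / m`, links the predictions to an arbitrary comparator. -/
lemma dynamic_regret_le {B R lam : ℝ} (hB : 0 < B) {y x w : ℕ → ℝ} {n m : ℕ} (hn : 1 ≤ n)
    (hm : 1 ≤ m) (hlam : 0 ≤ lam) (hRlam : R ≤ 2 * lam * (2 * B / m))
    (hR : ∀ a b, 1 ≤ a → a ≤ b → b ≤ n → ∀ q ∈ Set.Icc (-B) B,
      ∑ t ∈ Icc a b, (sqLoss y t (x t) - sqLoss y t q) ≤ R)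
    (hw : ∀ t ∈ Icc 1 n, w t ∈ Set.Icc (-B) B) :
    regret n y x w ≤ R + 2 * lam * TV n w + n * (2 * B / m) ^ 2 := by
  obtain ⟨u, hu, hmin⟩ := exists_minimizer hB.le lam n y
  obtain ⟨v, hv, hdist, hbd, hjump⟩ := exists_quantization hB hm hu
  have hr0 : 0 < 2 * B / m := by
    have : (0 : ℝ) < m := by exact_mod_cast hm
    positivity
  have h1 := piecewise_regret_le hR (c := 2 * lam) (by positivity) hRlam hv
    (fun t => (hjump t).imp_right fun h => by
      rcases h with ⟨h, _⟩ | ⟨h, _⟩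
      · exact le_abs.mpr (Or.inl (by linarith))
      · exact le_abs.mpr (Or.inr (by linarith))) hn
  have h2 := penalized_le_of_minimizer (v := v) hu hmin (fun t _ => hbd t) fun t ht => by
    obtain ⟨k, rfl⟩ : ∃ k, t = k + 1 := ⟨t - 1, by rw [mem_Icc] at ht; omega⟩
    rw [Nat.add_sub_cancel]
    rcases hjump k with h | ⟨h, h'⟩ | ⟨h, h'⟩
    · exact Or.inl h
    · exact Or.inr (Or.inl ⟨by linarith, h'⟩)
    · exact Or.inr (Or.inr ⟨by linarith, h'⟩)
  have h3 := hmin w hw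
  have h4 : ∑ t ∈ Icc 1 n, (u t - v t) ^ 2 ≤ n * (2 * B / m) ^ 2 := by
    simpa using sum_le_card_nsmul (Icc 1 n) _ _ fun t _ => hdist t
  have h5 : regret n y x w = ∑ t ∈ Icc 1 n, (sqLoss y t (x t) - sqLoss y t (v t))
      + ∑ t ∈ Icc 1 n, sqLoss y t (v t) - ∑ t ∈ Icc 1 n, sqLoss y t (w t) := by
    rw [regret, ← sum_add_distrib, ← sum_sub_distrib]
    exact sum_congr rfl fun t _ => by simp only [sqLoss]; ring
  unfold penalized at h2 h3
  linarith

lemma regret_le_mul {B G : ℝ} {y x w : ℕ → ℝ} {n : ℕ} (hy : ∀ t ∈ Icc 1 n, |y t| ≤ G)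
    (hx : ∀ t ∈ Icc 1 n, x t ∈ Set.Icc (-B) B) : regret n y x w ≤ n * (G + B) ^ 2 := by
  have h := sum_le_card_nsmul (Icc 1 n) (fun t => (y t - x t) ^ 2 - (y t - w t) ^ 2)
    ((G + B) ^ 2) fun t ht => by
      have := sqLoss_le (hy t ht) (hx t ht)
      simp only [sqLoss] at this
      linarith [sq_nonneg (y t - w t)]
  simpa [regret] using h

/-- The choice of scales: with `T ≥ n^{1/3} V^{2/3}` for the variation `V` of the comparator, the
penalty is `R * q` and the mesh is about `1 / q`, where `q = √(n / T)`. Then the penalty of the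
comparator is `R q V ≤ R T`, and the squared quantization error is `n / q² = T`. -/
lemma dynamic_regret_le_of_sq_TV_le {B G R T : ℝ} (hB : 1 ≤ B) {y x w : ℕ → ℝ} {n : ℕ}
    (hn : 1 ≤ n) (hy : ∀ t ∈ Icc 1 n, |y t| ≤ G)
    (hx : ∀ t ∈ Icc 1 n, x t ∈ Set.Icc (-B) B) (hRG : (G + B) ^ 2 ≤ R) (hR1 : 1 ≤ R)
    (hR : ∀ a b, 1 ≤ a → a ≤ b → b ≤ n → ∀ q ∈ Set.Icc (-B) B,
      ∑ t ∈ Icc a b, (sqLoss y t (x t) - sqLoss y t q) ≤ R)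
    (hw : ∀ t ∈ Icc 1 n, w t ∈ Set.Icc (-B) B) (hT1 : 1 ≤ T) (hT : n * TV n w ^ 2 ≤ T ^ 3) :
    regret n y x w ≤ 4 * R * T := by
  have hn0 : (0 : ℝ) < n := by exact_mod_cast hn
  have hT0 : 0 < T := by linarith
  -- if `T` exceeds `n`, the mesh would exceed the box, but then the trivial bound suffices
  rcases le_total (n : ℝ) T with hnT | hnT
  · have h1 := regret_le_mul (w := w) hy hx
    have h2 : (n : ℝ) * (G + B) ^ 2 ≤ T * R := mul_le_mul hnT hRG (sq_nonneg _) hT0.le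
    nlinarith
  · set q := Real.sqrt (n / T) with hq
    have hq2 : q ^ 2 = n / T := Real.sq_sqrt (by positivity)
    have hq1 : 1 ≤ q := Real.one_le_sqrt.mpr ((one_le_div hT0).mpr hnT)
    set m := ⌊4 * B * q⌋₊ with hmdef
    have hBq : 1 ≤ B * q := by nlinarith
    have hm_le : (m : ℝ) ≤ 4 * B * q := Nat.floor_le (by nlinarith)
    have hm_ge : 2 * B * q ≤ m := by linarith [Nat.lt_floor_add_one (4 * B * q)]
    have hm1 : 1 ≤ m := by exact_mod_cast (by linarith : (1 : ℝ) ≤ m)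
    have hm0 : (0 : ℝ) < m := by linarith
    have hqV : q * TV n w ≤ T := by
      refine abs_le_of_sq_le_sq' ?_ hT0.le |>.2
      rw [mul_pow, hq2, div_mul_eq_mul_div, div_le_iff₀ hT0]
      linarith [show T ^ 2 * T = T ^ 3 by ring]
    have hmesh : n * (2 * B / m) ^ 2 ≤ T := by
      have h1 : 2 * B / m ≤ 1 / q := by
        rw [div_le_div_iff₀ hm0 (by linarith)]
        linarith
      calc n * (2 * B / m) ^ 2 ≤ n * (1 / q) ^ 2 := by gcongr
        _ = T := by rw [div_pow, hq2]; field_simp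
    have h := dynamic_regret_le (lam := R * q) (by linarith) hn hm1 (by positivity) (by
      rw [mul_div_assoc', le_div_iff₀ hm0]
      nlinarith [mul_le_mul_of_nonneg_left hm_le (by linarith : 0 ≤ R)]) hR hw
    nlinarith [mul_le_mul_of_nonneg_left hqV (by linarith : 0 ≤ R)]

end FLHOGD

open FLHOGD in
theorem theorem1 :
    ∃ p : ℕ, ∀ B G : ℝ, 1 ≤ B → B ≤ G →
      ∃ K : ℝ, 0 < K ∧
        ∀ (n : ℕ) (y z : ℕ → ℝ),
          (∀ t ∈ Finset.Icc 1 n, |y t| ≤ G) →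
          (∀ j ∈ Finset.Icc 1 n, |z j| ≤ B) →
          (∀ t ∈ Finset.Icc 1 n, FLHOGD.predict B G z y t ∈ Set.Icc (-B) B) ∧
          ∀ (C : ℝ), ∀ w ∈ FLHOGD.TVClass B n C,
            FLHOGD.regret n y (FLHOGD.predict B G z y) w ≤
              K * (1 + Real.log (n : ℝ)) ^ p *
                max ((n : ℝ) ^ (1 / 3 : ℝ) * C ^ (2 / 3 : ℝ)) 1 := by
  refine ⟨1, fun B G hB hG => ⟨12 * (G + B) ^ 2,
    mul_pos (by norm_num) (pow_pos (by linarith) 2), fun n y z hy hz =>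
    ⟨fun t ht => predict_mem hz G ht, fun C w ⟨hC, hw⟩ => ?_⟩⟩⟩
  rcases Nat.eq_zero_or_pos n with rfl | hn
  · simp only [regret, zero_lt_one, Finset.Icc_eq_empty_of_lt, Finset.sum_empty, Nat.cast_zero,
      Real.log_zero, add_zero, one_pow, mul_one]
    positivity
  set T := max ((n : ℝ) ^ (1 / 3 : ℝ) * C ^ (2 / 3 : ℝ)) 1 with hTdef
  have hC0 : 0 ≤ C := (TV_nonneg n w).trans hC
  have hlog : 0 ≤ Real.log n := Real.log_nonneg (by exact_mod_cast hn)
  have hGB : 1 ≤ (G + B) ^ 2 := one_le_pow₀ (by linarith)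
  have hT : n * TV n w ^ 2 ≤ T ^ 3 := by
    have h1 : ((n : ℝ) ^ (1 / 3 : ℝ) * C ^ (2 / 3 : ℝ)) ^ 3 = n * C ^ 2 := by
      rw [mul_pow, ← Real.rpow_natCast, ← Real.rpow_natCast, ← Real.rpow_mul (by positivity),
        ← Real.rpow_mul hC0]
      norm_num
    calc n * TV n w ^ 2 ≤ n * C ^ 2 := by
          gcongr
          exact TV_nonneg n w
      _ = ((n : ℝ) ^ (1 / 3 : ℝ) * C ^ (2 / 3 : ℝ)) ^ 3 := h1.symm
      _ ≤ T ^ 3 := by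
          gcongr
          exact le_max_left _ _
  have h := dynamic_regret_le_of_sq_TV_le (x := predict B G z y) (w := w)
    (R := 3 * (G + B) ^ 2 * (1 + Real.log n)) hB hn hy (fun t ht => predict_mem hz G ht)
    (by nlinarith) (by nlinarith)
    (fun a b ha hab hb q hq => predict_interval_regret_le (by linarith) hy hz ha hab hb hq)
    (fun t ht => abs_le.mp (hw t ht)) (le_max_right _ _) hT
  linarith
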